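/- Let $n\ge 3$ be an integer and let $$\mathcal{B}(n,2,1,1)=\{a=(a_1,\dots,a_n)\in\mathbb{Z}^n:\ a_i\in\{-1,0,1\}\text{ for all } i,\ \text{and at most two of the } a_i \text{ are nonzero}\}.$$ A lattice tiling of $\mathbb{Z}^n$ by a set $V\subseteq\mathbb{Z}^n$ is a lattice $\Lambda\subseteq\mathbb{Z}^n$ (a subgroup of finite index) such that the translates $\ell+V$, $\ell\in\Lambda$, are pairwise disjoint and their union is $\mathbb{Z}^n$. Then there exists a lattice tiling of $\mathbb{Z}^n$ by $\mathcal{B}(n,2,1,1)$ if and only if $n=11$. -/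

import Mathlib

open scoped Pointwise

/-- The limited-magnitude error ball `B(n, t, k₊, k₋)`: the integer vectors of length `n` with all
entries in `[-k₋, k₊]` and at most `t` nonzero entries. -/
def errorBall (n t kPlus kMinus : ℕ) : Set (Fin n → ℤ) :=
  {a | (∀ i, a i ∈ Set.Icc (-(kMinus : ℤ)) (kPlus : ℤ)) ∧ hammingNorm a ≤ t}

/-- `Λ` is a lattice (a subgroup of finite index, that is, of full rank) in `ℤⁿ` whose translates
`l + V`, `l ∈ Λ`, are pairwise disjoint and cover `ℤⁿ`. -/
structure IsLatticeTiling {n : ℕ} (Λ : AddSubgroup (Fin n → ℤ)) (V : Set (Fin n → ℤ)) : Prop where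
  finiteIndex : Λ.FiniteIndex
  disjoint : (Λ : Set (Fin n → ℤ)).PairwiseDisjoint (fun l => l +ᵥ V)
  cover : ⋃ l ∈ Λ, (l +ᵥ V) = Set.univ

/-!
A lattice tiling by the ball `B(n, 2, 1, 1)` is the same as a homomorphism `φ` from `ℤⁿ` onto a
finite abelian group `G` that is bijective on the ball (`bijOn_of_isLatticeTiling`,
`isLatticeTiling_ker`). Write `sᵢ` for the images of the unit vectors and, in the integral group ring
of `G`, `Yₖ` for the sum of `0` and the elements `±k sᵢ`, and `Γ` for the sum of all elements. The
tiling condition gives the quadratic equation `Y₁² = 2 Γ + Y₂ + 2 n - 2` (`unitBall_sq`). In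
particular `G` has order `2 n² + 1`, which is odd, so doubling yields
`Y₂² = 2 Γ + Y₄ + 2 n - 2` as well.

For existence with `n = 11`, the syndrome map of the perfect ternary Golay code is bijective on the
ball (`bijOn_golaySyndrome`): the minimum distance is `5`, and the ball has `3 ^ 5` elements.

For the converse, consider the coefficients `e g` of `Y₁ Y₂`. The two quadratic equations determine
their sum, the sum of their squares, and their sum over the elements `±sᵢ`. The Frobenius
congruence `Y₁³ ≡ Y₃` determines them modulo `3` in terms of the multiplicities `x g` and `z g` of
`g` among the `±sᵢ` and among the `±3 sᵢ`. If `n ≢ 2` modulo `3`, these data are contradictory by a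
convexity argument (`CoeffRelations.not_zero_mod_three`, `CoeffRelations.not_one_mod_three`). If
`n ≡ 2` modulo `3`, the solution `±3 sᵢ = ±sᵢ ± 2 sᵢ` gives `e ≥ x + z`, which the congruence improves
to `e ≥ x + z + 2`, and comparing sums gives equality away from `0` (`CoeffRelations.e_eq`). The sum
of squares then forces `3 sᵢ = 0` for all `i` (`mod_three_and_smul_eq_zero`).

Hence `3 G = 0` and `Y₂ = Y₁`, so a nontrivial character maps `Y₁` to an integer `y` with
`y² = y + 2 n - 2`. Summing over all characters shows that `2 y - 1` divides `63`, which leaves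
`n = 11`, `56`, `497`, and `2 n² + 1` is a power of `3` only for `n = 11` (`eq_eleven`).
-/

namespace LatticeTiling
open Finset AddMonoidAlgebra
open scoped AddMonoidAlgebra

/-! ### Tilings and homomorphisms -/

theorem bijOn_of_isLatticeTiling {n : ℕ} {Λ : AddSubgroup (Fin n → ℤ)} {V : Set (Fin n → ℤ)}
    (h : IsLatticeTiling Λ V) : Set.BijOn (QuotientAddGroup.mk' Λ) V Set.univ := by
  refine ⟨fun _ _ => trivial, ?_, ?_⟩
  · intro a ha b hb hab
    have hm : -a + b ∈ Λ := QuotientAddGroup.eq.1 hab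
    by_contra hne
    have hne' : (0 : Fin n → ℤ) ≠ -b + a := by
      intro h0
      apply hne
      have := (neg_add_eq_zero.1 h0.symm)
      exact this.symm
    have hm' : -b + a ∈ Λ := by
      have := Λ.neg_mem hm
      rwa [neg_add, neg_neg, add_comm] at this
    have hd := h.disjoint Λ.zero_mem hm' hne'
    exact Set.disjoint_left.1 hd (show a ∈ (0 : Fin n → ℤ) +ᵥ V by simpa using ha)
      ⟨b, hb, by simp⟩
  · intro q _
    obtain ⟨x, rfl⟩ := QuotientAddGroup.mk'_surjective Λ q
    have hx : x ∈ ⋃ l ∈ Λ, (l +ᵥ V) := h.cover ▸ Set.mem_univ x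
    obtain ⟨l, hl, v, hv, rfl⟩ := Set.mem_iUnion₂.1 hx
    refine ⟨v, hv, ?_⟩
    refine QuotientAddGroup.eq.2 ?_
    simpa [add_comm] using hl

theorem isLatticeTiling_ker {n : ℕ} {G : Type*} [AddCommGroup G] [Finite G]
    (φ : (Fin n → ℤ) →+ G) {V : Set (Fin n → ℤ)} (h : Set.BijOn φ V Set.univ) :
    IsLatticeTiling φ.ker V := by
  refine ⟨inferInstance, ?_, ?_⟩
  · intro l hl l' hl' hne
    refine Set.disjoint_left.2 ?_
    rintro _ ⟨v, hv, rfl⟩ ⟨v', hv', hvv⟩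
    have hvv : l' + v' = l + v := hvv
    have h1 : φ v' = φ v := by
      have := congrArg φ hvv
      rwa [map_add, map_add, φ.mem_ker.1 hl, φ.mem_ker.1 hl', zero_add, zero_add] at this
    have := h.injOn hv' hv h1
    subst this
    exact hne (add_right_cancel hvv).symm
  · refine Set.eq_univ_of_forall fun x => ?_
    obtain ⟨v, hv, hvx⟩ := h.surjOn (Set.mem_univ (φ x))
    refine Set.mem_iUnion₂.2 ⟨x - v, ?_, v, hv, by simp⟩
    rw [φ.mem_ker, map_sub, hvx, sub_self]

/-! ### Signed subsets -/

/-- The vector with entry `1` on `R`, entry `-1` on `S \ R` and entry `0` outside `S`. -/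
def signVector {n : ℕ} (S R : Finset (Fin n)) : Fin n → ℤ :=
  ∑ i ∈ R, Pi.single i 1 + ∑ i ∈ S \ R, -Pi.single i 1

theorem signVector_apply {n : ℕ} {S R : Finset (Fin n)} (h : R ⊆ S) (i : Fin n) :
    signVector S R i = if i ∈ R then 1 else if i ∈ S then -1 else 0 := by
  have := @h i
  by_cases h1 : i ∈ R <;> by_cases h2 : i ∈ S <;>
    simp_all [signVector, Finset.sum_apply, Pi.single_apply]

/-- The signed subsets of `Fin n` with at most two elements: pairs `(S, R)` with `R ⊆ S`, where
`R` is the set of positions of the sign `+1`. -/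
def smallSignedSets (n : ℕ) : Finset (Σ _ : Finset (Fin n), Finset (Fin n)) :=
  (univ.filter fun S : Finset (Fin n) => #S ≤ 2).sigma Finset.powerset

/-- The ball `B(n, 2, 1, 1)` is parametrized by signed subsets of size at most two. -/
theorem bijOn_signVector (n : ℕ) :
    Set.BijOn (fun p : Σ _ : Finset (Fin n), Finset (Fin n) => signVector p.1 p.2)
      (smallSignedSets n) (errorBall n 2 1 1) := by
  refine ⟨?_, ?_, ?_⟩
  · rintro ⟨S, R⟩ h
    simp only [smallSignedSets, coe_sigma, Set.mem_sigma_iff, mem_coe, mem_filter, mem_univ,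
      true_and, mem_powerset] at h
    refine ⟨fun i => ?_, ?_⟩
    · simp only [signVector_apply h.2]
      split_ifs <;> simp
    · refine le_trans (card_le_card ?_) h.1
      intro i hi
      have hi : signVector S R i ≠ 0 := by simpa using hi
      rw [signVector_apply h.2] at hi
      by_contra hS
      exact hi (by rw [if_neg (fun h' => hS (h.2 h')), if_neg hS])
  · rintro ⟨S, R⟩ h ⟨S', R'⟩ h' hh
    simp only [smallSignedSets, coe_sigma, Set.mem_sigma_iff, mem_coe, mem_filter, mem_univ,
      true_and, mem_powerset] at h h'
    have key : ∀ i, (i ∈ R ↔ i ∈ R') ∧ (i ∈ S ↔ i ∈ S') := by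
      intro i
      have h1 : signVector S R i = signVector S' R' i := congrFun hh i
      rw [signVector_apply h.2, signVector_apply h'.2] at h1
      have := @h.2 i
      have := @h'.2 i
      split_ifs at h1 <;> simp_all
    obtain rfl : S = S' := Finset.ext fun i => (key i).2
    obtain rfl : R = R' := Finset.ext fun i => (key i).1
    rfl
  · rintro a ⟨ha, hw⟩
    refine ⟨⟨univ.filter fun i => a i ≠ 0, univ.filter fun i => a i = 1⟩, ?_, ?_⟩
    · simp only [smallSignedSets, coe_sigma, Set.mem_sigma_iff, mem_coe, mem_filter, mem_univ,
        true_and, mem_powerset]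
      refine ⟨hw, fun i hi => ?_⟩
      simp only [mem_filter, mem_univ, true_and] at hi ⊢
      simp [hi]
    · funext i
      dsimp only
      rw [signVector_apply]
      · have := ha i
        simp only [Set.mem_Icc, Nat.cast_one] at this
        simp only [mem_filter, mem_univ, true_and]
        split_ifs <;> omega
      · intro i hi
        simp only [mem_filter, mem_univ, true_and] at hi ⊢
        simp [hi]

theorem sum_smallSignedSets {n : ℕ} {M : Type*} [AddCommMonoid M]
    (F : Finset (Fin n) → Finset (Fin n) → M) :
    ∑ p ∈ smallSignedSets n, F p.1 p.2 =
      ∑ k ∈ range 3, ∑ S ∈ powersetCard k univ, ∑ R ∈ S.powerset, F S R := by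
  rw [smallSignedSets, sum_sigma]
  dsimp only
  rw [← sum_fiberwise_of_maps_to (g := Finset.card) (t := range 3)]
  · refine sum_congr rfl fun k hk => sum_congr ?_ fun _ _ => rfl
    ext S
    simp only [mem_range] at hk
    simp only [mem_filter, mem_univ, true_and, mem_powersetCard, subset_univ]
    omega
  · intro S hS
    simp only [mem_filter, mem_univ, true_and] at hS
    simp only [mem_range]
    omega

theorem card_smallSignedSets (n : ℕ) :
    #(smallSignedSets n) = ∑ k ∈ range 3, n.choose k * 2 ^ k := by
  rw [card_eq_sum_ones, sum_smallSignedSets (fun _ _ => 1)]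
  refine sum_congr rfl fun k _ => ?_
  rw [sum_congr rfl (g := fun _ => 2 ^ k)]
  · simp
  · intro S hS
    simp [(mem_powersetCard.1 hS).2]

/-- By counting, a map to a set of the size of the ball is bijective on the ball if it is injective
there. -/
theorem bijOn_of_injOn_of_card_le {n : ℕ} {G : Type*} [Fintype G] {φ : (Fin n → ℤ) → G}
    (hinj : Set.InjOn φ (errorBall n 2 1 1))
    (hcard : Fintype.card G ≤ ∑ k ∈ range 3, n.choose k * 2 ^ k) :
    Set.BijOn φ (errorBall n 2 1 1) Set.univ := by
  refine ⟨fun _ _ => trivial, hinj, fun q _ => ?_⟩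
  have hb := bijOn_signVector n
  rw [← card_smallSignedSets, ← card_univ] at hcard
  obtain ⟨p, hp, rfl⟩ := surjOn_of_injOn_of_card_le (φ ∘ fun p => signVector p.1 p.2)
    (fun _ _ => by simp) (hinj.comp hb.injOn hb.mapsTo) hcard (mem_coe.2 (mem_univ q))
  exact ⟨_, hb.mapsTo hp, rfl⟩

/-- The square of a sum in terms of the second elementary symmetric sum. -/
theorem sum_sq_eq {ι R : Type*} [DecidableEq ι] [CommRing R] (s : Finset ι) (f : ι → R) :
    (∑ i ∈ s, f i) ^ 2 =
      ∑ i ∈ s, f i ^ 2 + 2 * ∑ S ∈ powersetCard 2 s, ∏ i ∈ S, f i := by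
  induction s using Finset.induction_on with
  | empty =>
    have h : powersetCard 2 (∅ : Finset ι) = ∅ := powersetCard_eq_empty.2 (by simp)
    simp [h]
  | insert a s ha ih =>
    have hd : Disjoint (powersetCard 2 s) ((powersetCard 1 s).image (insert a)) := by
      rw [disjoint_left]
      intro S hS hS'
      obtain ⟨S', -, rfl⟩ := mem_image.1 hS'
      exact ha ((mem_powersetCard.1 hS).1 (mem_insert_self a S'))
    have himg : ∑ S ∈ (powersetCard 1 s).image (insert a), ∏ i ∈ S, f i = f a * ∑ i ∈ s, f i := by
      rw [powersetCard_one, map_eq_image, image_image, sum_image, mul_sum]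
      · refine sum_congr rfl fun i hi => ?_
        have : a ≠ i := fun h => ha (h ▸ hi)
        simp [prod_pair this]
      · intro i hi j hj hij
        have hij : ({a, i} : Finset ι) = {a, j} := hij
        have : i ∈ ({a, j} : Finset ι) := hij ▸ (by simp)
        simp only [mem_insert, mem_singleton] at this
        rcases this with h | h
        · exact absurd (h ▸ hi) ha
        · exact h
    rw [sum_insert ha, sum_insert ha, powersetCard_succ_insert ha, sum_union hd, himg, add_sq, ih]
    ring

/-! ### The integral group ring -/

section GroupRing

variable {G : Type*} [AddCommGroup G]

/-- The element `[x] + [-x]` of the integral group ring. -/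
noncomputable def pm (x : G) : ℤ[G] := single x 1 + single (-x) 1

theorem pm_mul_pm (x y : G) : pm x * pm y = pm (x + y) + pm (x - y) := by
  simp only [pm, add_mul, mul_add, single_mul_single, mul_one, neg_add, sub_eq_add_neg, neg_neg]
  rw [add_comm (-x) y]
  abel

theorem pm_zero : pm (0 : G) = 2 := by
  rw [pm, neg_zero, ← one_def, one_add_one_eq_two]

theorem single_sum_eq_prod {ι : Type*} (s : Finset ι) (f : ι → G) :
    (single (∑ i ∈ s, f i) 1 : ℤ[G]) = ∏ i ∈ s, single (f i) 1 := by
  classical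
  induction s using Finset.induction_on with
  | empty => simp [one_def]
  | insert a s ha ih => simp [ha, ← ih, single_mul_single]

/-- The sum of all elements of a finite group, in its integral group ring. -/
noncomputable def total (G : Type*) [AddCommGroup G] [Fintype G] : ℤ[G] := ∑ g : G, single g 1

/-- The sum of the elements `±k sᵢ` in the integral group ring, with multiplicity. -/
noncomputable def signedSum {n : ℕ} (s : Fin n → G) (k : ℤ) : ℤ[G] := ∑ i, pm (k • s i)

/-- The sum of `0` and of the elements `±k sᵢ` in the integral group ring, with multiplicity. -/
noncomputable def unitBall {n : ℕ} (s : Fin n → G) (k : ℤ) : ℤ[G] := 1 + signedSum s k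

/-- The tiling condition in the group ring: the ball is the disjoint union of its vectors of weight
`0`, `1` and `2`, and the vectors supported on `S` are the terms of the expansion of
`∏ i ∈ S, ([sᵢ] + [-sᵢ])`. -/
theorem total_eq_of_bijOn [Fintype G] {n : ℕ} {φ : (Fin n → ℤ) →+ G}
    (h : Set.BijOn φ (errorBall n 2 1 1) Set.univ) {s : Fin n → G}
    (hs : ∀ i, s i = φ (Pi.single i 1)) :
    total G = 1 + signedSum s 1 + ∑ S ∈ powersetCard 2 univ, ∏ i ∈ S, pm (s i) := by
  classical
  have hsv : ∀ S R : Finset (Fin n), φ (signVector S R) = ∑ i ∈ R, s i + ∑ i ∈ S \ R, -s i := by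
    intro S R
    simp [signVector, hs]
  have hb := h.comp (bijOn_signVector n)
  have h1 : total G = ∑ p ∈ smallSignedSets n, single (φ (signVector p.1 p.2)) 1 := by
    symm
    refine sum_nbij (fun p => φ (signVector p.1 p.2)) (fun _ _ => mem_univ _) hb.injOn ?_
      fun _ _ => rfl
    rw [coe_univ]
    exact hb.surjOn
  have h2 : ∀ S : Finset (Fin n),
      ∑ R ∈ S.powerset, (single (φ (signVector S R)) 1 : ℤ[G]) = ∏ i ∈ S, pm (s i) := by
    intro S
    simp only [pm, prod_add, hsv, ← single_sum_eq_prod, single_mul_single, mul_one]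
  rw [h1, sum_smallSignedSets fun S R => (single (φ (signVector S R)) 1 : ℤ[G])]
  simp only [h2, sum_range_succ, range_zero, sum_empty, zero_add, powersetCard_zero,
    sum_singleton, prod_empty, powersetCard_one, sum_map, Function.Embedding.coeFn_mk,
    prod_singleton, signedSum, one_smul]

/-- The tiling condition as a quadratic equation in the group ring. -/
theorem unitBall_sq {n : ℕ} {s : Fin n → G} {Γ : ℤ[G]}
    (h : Γ = 1 + signedSum s 1 + ∑ S ∈ powersetCard 2 univ, ∏ i ∈ S, pm (s i)) :
    unitBall s 1 ^ 2 = 2 * Γ + unitBall s 2 + (2 * (n : ℤ[G]) - 2) := by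
  have h1 : signedSum s 1 ^ 2 = signedSum s 2 + 2 * n +
      2 * ∑ S ∈ powersetCard 2 univ, ∏ i ∈ S, pm (s i) := by
    have h2 := sum_sq_eq univ fun i => pm (s i)
    have h3 : ∀ i, pm (s i) ^ 2 = pm ((2 : ℤ) • s i) + 2 := by
      intro i
      rw [sq, pm_mul_pm, sub_self, pm_zero, two_smul]
    simp only [h3, sum_add_distrib, sum_const, card_univ, Fintype.card_fin, nsmul_eq_mul] at h2
    simp only [signedSum, one_smul, h2]
    ring
  simp only [unitBall]
  linear_combination h1 - 2 * h

/-- The Frobenius congruence `Y₁³ ≡ Y₃` modulo `3`. -/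
theorem exists_unitBall_cube {n : ℕ} (s : Fin n → G) :
    ∃ W, unitBall s 1 ^ 3 = unitBall s 3 + 3 * W := by
  have hpm : ∀ x : G, pm x ^ 3 = pm ((3 : ℤ) • x) + 3 * pm x := by
    intro x
    have e1 : x + x + x = (3 : ℤ) • x := by
      rw [show (3 : ℤ) = 1 + 1 + 1 by norm_num, add_smul, add_smul, one_smul]
    have e2 : x + x - x = x := by abel
    rw [pow_succ, sq, pm_mul_pm, sub_self, pm_zero, add_mul, pm_mul_pm, e1, e2]
    ring
  have key : ∀ A : Finset (Fin n), ∃ W,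
      (∑ i ∈ A, pm (s i)) ^ 3 = ∑ i ∈ A, pm ((3 : ℤ) • s i) + 3 * W := by
    intro A
    induction A using Finset.induction_on with
    | empty => exact ⟨0, by simp⟩
    | insert a A ha ih =>
      obtain ⟨W, hW⟩ := ih
      rw [sum_insert ha, sum_insert ha]
      set B := ∑ i ∈ A, pm (s i)
      exact ⟨W + pm (s a) + pm (s a) ^ 2 * B + pm (s a) * B ^ 2, by
        linear_combination hW + hpm (s a)⟩
  obtain ⟨W, hW⟩ := key univ
  simp only [unitBall, signedSum, one_smul]
  set B := ∑ i, pm (s i)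
  exact ⟨W + B + B ^ 2, by linear_combination hW⟩

/-- The augmentation, that is, the sum of the coefficients. -/
noncomputable def augmentation (G : Type*) [AddCommGroup G] : ℤ[G] →+* ℤ :=
  (AddMonoidAlgebra.lift ℤ ℤ G 1).toRingHom

theorem augmentation_single (x : G) (r : ℤ) : augmentation G (single x r) = r := by
  simp [augmentation, AddMonoidAlgebra.lift_single]

theorem augmentation_eq_sum [Fintype G] (F : ℤ[G]) : augmentation G F = ∑ g, F.coeff g := by
  simp [augmentation, AddMonoidAlgebra.lift_apply, Finsupp.sum_fintype]

theorem augmentation_signedSum {n : ℕ} (s : Fin n → G) (k : ℤ) :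
    augmentation G (signedSum s k) = 2 * n := by
  simp [signedSum, pm, augmentation_single, mul_comm]

theorem augmentation_unitBall {n : ℕ} (s : Fin n → G) (k : ℤ) :
    augmentation G (unitBall s k) = 2 * n + 1 := by
  rw [unitBall, map_add, map_one, augmentation_signedSum, add_comm]

theorem augmentation_total [Fintype G] : augmentation G (total G) = Fintype.card G := by
  simp [total, augmentation_single]

theorem coeff_total [Fintype G] (g : G) : (total G).coeff g = 1 := by
  classical
  simp [total, Finsupp.finsetSum_apply, Finsupp.single_apply]

theorem coeff_mul_eq_sum [Fintype G] (E F : ℤ[G]) (g : G) :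
    (E * F).coeff g = ∑ x, E.coeff x * F.coeff (g - x) := by
  classical
  rw [coeff_mul_antidiag E F g (univ.map ⟨fun x => (x, g - x), fun x y h => (Prod.ext_iff.1 h).1⟩),
    sum_map]
  · rfl
  · rintro ⟨a, b⟩
    rw [mem_map]
    constructor
    · rintro ⟨x, -, hx⟩
      obtain ⟨rfl, rfl⟩ := Prod.ext_iff.1 hx
      exact add_sub_cancel x g
    · intro h
      have h : a + b = g := h
      exact ⟨a, mem_univ a, Prod.ext rfl (by simp [← h])⟩

theorem coeff_mul_total [Fintype G] (F : ℤ[G]) (g : G) :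
    (F * total G).coeff g = augmentation G F := by
  simp [coeff_mul_eq_sum, coeff_total, augmentation_eq_sum]

theorem coeff_one [DecidableEq G] (g : G) : (1 : ℤ[G]).coeff g = if g = 0 then 1 else 0 := by
  rw [one_def, coeff_single, Finsupp.single_apply]
  simp [eq_comm]

/-- The ring endomorphism of the group ring induced by the multiplication by `k`. -/
noncomputable def dilation (G : Type*) [AddCommGroup G] (k : ℤ) : ℤ[G] →+* ℤ[G] :=
  mapDomainRingHom ℤ (zsmulAddGroupHom k : G →+ G)

theorem dilation_single (k : ℤ) (x : G) (r : ℤ) :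
    dilation G k (single x r) = single (k • x) r := by
  simp [dilation]

theorem dilation_unitBall {n : ℕ} (s : Fin n → G) (k j : ℤ) :
    dilation G k (unitBall s j) = unitBall s (k * j) := by
  simp [unitBall, signedSum, pm, dilation_single, mul_smul]

theorem coeff_dilation {k : ℤ} (hk : Function.Injective fun x : G => k • x) (F : ℤ[G]) (g : G) :
    (dilation G k F).coeff (k • g) = F.coeff g := by
  have : (dilation G k F).coeff = Finsupp.mapDomain (fun x : G => k • x) F.coeff := rfl
  rw [this]
  exact Finsupp.mapDomain_apply hk _ _

theorem dilation_total [Fintype G] {k : ℤ} (hk : Function.Injective fun x : G => k • x) :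
    dilation G k (total G) = total G := by
  simp only [total, map_sum, dilation_single]
  exact Function.Bijective.sum_comp (Finite.injective_iff_bijective.1 hk)
    fun g => (single g 1 : ℤ[G])

theorem coeff_neg_signedSum {n : ℕ} (s : Fin n → G) (k : ℤ) (g : G) :
    (signedSum s k).coeff (-g) = (signedSum s k).coeff g := by
  classical
  simp only [signedSum, pm, coeff_sum, coeff_add, coeff_single, Finsupp.finsetSum_apply,
    Finsupp.add_apply, Finsupp.single_apply]
  refine sum_congr rfl fun i _ => ?_
  rw [add_comm]
  rw [neg_inj, ← neg_eq_iff_eq_neg]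

theorem coeff_neg_unitBall {n : ℕ} (s : Fin n → G) (k : ℤ) (g : G) :
    (unitBall s k).coeff (-g) = (unitBall s k).coeff g := by
  classical
  rw [unitBall, coeff_add, Finsupp.add_apply, Finsupp.add_apply, coeff_neg_signedSum, coeff_one,
    coeff_one]
  simp

theorem coeff_neg_mul [Fintype G] {E F : ℤ[G]} (hE : ∀ g, E.coeff (-g) = E.coeff g)
    (hF : ∀ g, F.coeff (-g) = F.coeff g) (g : G) : (E * F).coeff (-g) = (E * F).coeff g := by
  rw [coeff_mul_eq_sum, coeff_mul_eq_sum, ← Equiv.sum_comp (Equiv.neg G)]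
  refine sum_congr rfl fun x _ => ?_
  rw [Equiv.neg_apply, hE, ← hF, neg_sub, neg_sub_neg, ← hF, neg_sub]

theorem coeff_mul_nonneg [Fintype G] {E F : ℤ[G]} (hE : ∀ g, 0 ≤ E.coeff g)
    (hF : ∀ g, 0 ≤ F.coeff g) (g : G) : 0 ≤ (E * F).coeff g := by
  rw [coeff_mul_eq_sum]
  exact sum_nonneg fun x _ => mul_nonneg (hE _) (hF _)

theorem coeff_sum_nonneg {X ι : Type*} {A : Finset ι} {F : ι → ℤ[X]}
    (hF : ∀ i ∈ A, ∀ g, 0 ≤ (F i).coeff g) (g : X) : 0 ≤ (∑ i ∈ A, F i).coeff g := by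
  rw [coeff_sum, Finsupp.finsetSum_apply]
  exact sum_nonneg fun i hi => hF i hi g

theorem coeff_pm_nonneg (x g : G) : 0 ≤ (pm x).coeff g := by
  classical
  simp only [pm, coeff_add, coeff_single, Finsupp.add_apply, Finsupp.single_apply]
  split_ifs <;> simp

theorem coeff_signedSum_nonneg {n : ℕ} (s : Fin n → G) (k : ℤ) (g : G) :
    0 ≤ (signedSum s k).coeff g :=
  coeff_sum_nonneg (fun _ _ => coeff_pm_nonneg _) g

/-- The products `pm (sᵢ) * pm (2 sᵢ)` contribute `±sᵢ` and `±3 sᵢ` to the product of the two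
signed sums. -/
theorem coeff_signedSum_mul_ge [Fintype G] {n : ℕ} (s : Fin n → G) (g : G) :
    (signedSum s 1).coeff g + (signedSum s 3).coeff g ≤
      (signedSum s 1 * signedSum s 2).coeff g := by
  classical
  have h : signedSum s 1 * signedSum s 2 = signedSum s 1 + signedSum s 3 +
      ∑ i, ∑ j ∈ univ.erase i, pm ((1 : ℤ) • s i) * pm ((2 : ℤ) • s j) := by
    simp only [signedSum, sum_mul_sum, ← sum_add_distrib]
    refine sum_congr rfl fun i _ => ?_
    rw [← add_sum_erase _ _ (mem_univ i), pm_mul_pm, ← add_smul, ← sub_smul,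
      show (1 : ℤ) - 2 = -1 by norm_num, show (1 : ℤ) + 2 = 3 by norm_num, neg_smul]
    have : pm (-((1 : ℤ) • s i)) = pm ((1 : ℤ) • s i) := by
      rw [pm, pm, neg_neg, add_comm]
    rw [this, add_comm (pm ((3 : ℤ) • s i))]
  rw [h, coeff_add, coeff_add, Finsupp.add_apply, Finsupp.add_apply]
  refine le_add_of_nonneg_right (coeff_sum_nonneg (fun i _ => ?_) g)
  exact coeff_sum_nonneg fun j _ =>
    coeff_mul_nonneg (coeff_pm_nonneg _) (coeff_pm_nonneg _)

theorem coeff_unitBall_two_mul_zero {n : ℕ} {s : Fin n → G}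
    (hinj : Function.Injective fun x : G => (2 : ℤ) • x) (k : ℤ) :
    (unitBall s (2 * k)).coeff 0 = (unitBall s k).coeff 0 := by
  have := coeff_dilation hinj (unitBall s k) 0
  rwa [dilation_unitBall, smul_zero] at this

theorem coeff_signedSum_le_smul {n : ℕ} (s : Fin n → G) (k : ℤ) (g : G) :
    (signedSum s 1).coeff g ≤ (signedSum s k).coeff (k • g) := by
  classical
  simp only [signedSum, pm, coeff_sum, coeff_add, coeff_single, Finsupp.finsetSum_apply,
    Finsupp.add_apply, Finsupp.single_apply, one_smul]
  refine sum_le_sum fun i _ => add_le_add ?_ ?_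
  · by_cases h : s i = g
    · simp [h]
    · rw [if_neg h]; split_ifs <;> simp
  · by_cases h : -s i = g
    · simp [← h]
    · rw [if_neg h]; split_ifs <;> simp

theorem smul_eq_zero_of_coeff_signedSum_zero {n : ℕ} {s : Fin n → G} {k : ℤ}
    (h : (signedSum s k).coeff 0 = 2 * n) (i : Fin n) : k • s i = 0 := by
  classical
  have hpm : ∀ x : G, (pm x).coeff 0 = if x = 0 then 2 else 0 := by
    intro x
    simp only [pm, coeff_add, coeff_single, Finsupp.add_apply, Finsupp.single_apply, neg_eq_zero]
    split_ifs <;> rfl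
  have h1 : ∑ j, (2 - (pm (k • s j)).coeff 0) = 0 := by
    rw [signedSum, coeff_sum, Finsupp.finsetSum_apply] at h
    rw [sum_sub_distrib, h]
    simp [mul_comm]
  have h2 := (sum_eq_zero_iff_of_nonneg fun j _ => ?_).1 h1 i (mem_univ i)
  · rw [hpm] at h2
    by_contra h3
    simp [h3] at h2
  · rw [hpm]; split_ifs <;> simp

end GroupRing

/-! ### Coefficients of the product of the unit ball and its double -/

section Coefficients

variable {G : Type*} [AddCommGroup G] [Fintype G] {n : ℕ} {s : Fin n → G}

theorem card_eq_of_unitBall_sq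
    (hY : unitBall s 1 ^ 2 = 2 * total G + unitBall s 2 + (2 * (n : ℤ[G]) - 2)) :
    (Fintype.card G : ℤ) = 2 * n ^ 2 + 1 := by
  have h := congrArg (augmentation G) hY
  simp only [map_pow, map_add, map_sub, map_mul, map_natCast, map_ofNat, augmentation_unitBall,
    augmentation_total] at h
  linarith

/-- The order of the group is odd, so that doubling is injective. -/
theorem injective_two_smul (hG : (Fintype.card G : ℤ) = 2 * n ^ 2 + 1) :
    Function.Injective fun x : G => (2 : ℤ) • x := by
  intro x y hxy
  have h1 : (2 : ℤ) • (x - y) = 0 := by rw [smul_sub]; exact sub_eq_zero.2 hxy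
  have h2 : (Fintype.card G : ℤ) • (x - y) = 0 := by
    rw [natCast_zsmul]; exact card_nsmul_eq_zero
  rw [hG, add_smul, mul_comm, mul_smul, h1, smul_zero, zero_add, one_smul] at h2
  exact sub_eq_zero.1 h2

/-- The elements `±sᵢ` are nonzero and pairwise distinct. -/
theorem coeff_signedSum_zero_one
    (h : total G = 1 + signedSum s 1 + ∑ S ∈ powersetCard 2 univ, ∏ i ∈ S, pm (s i)) :
    (signedSum s 1).coeff 0 = 0 ∧
      ∀ g, (signedSum s 1).coeff g = 0 ∨ (signedSum s 1).coeff g = 1 := by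
  classical
  have key : ∀ g : G, (if g = 0 then 1 else 0) + (signedSum s 1).coeff g ≤ 1 := by
    intro g
    have hg := congrArg (fun F : ℤ[G] => F.coeff g) h
    simp only [coeff_total, coeff_add, Finsupp.add_apply, coeff_one] at hg
    have : 0 ≤ (∑ S ∈ powersetCard 2 univ, ∏ i ∈ S, pm (s i)).coeff g := by
      refine coeff_sum_nonneg (fun S hS => ?_) g
      obtain ⟨i, j, hij, rfl⟩ := card_eq_two.1 (mem_powersetCard.1 hS).2
      rw [prod_pair hij]
      exact coeff_mul_nonneg (coeff_pm_nonneg _) (coeff_pm_nonneg _)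
    linarith
  have hnn := coeff_signedSum_nonneg s 1
  refine ⟨?_, fun g => ?_⟩
  · have := key 0
    have := hnn 0
    rw [if_pos rfl] at *
    omega
  · have := key g
    have := hnn g
    split_ifs at * <;> omega

/-- Obtained by writing `Y₁³` both as `Y₁ (2 Γ + Y₂ + 2 n - 2)` and as `Y₃` modulo `3`. -/
theorem coeff_mod_three
    (hY : unitBall s 1 ^ 2 = 2 * total G + unitBall s 2 + (2 * (n : ℤ[G]) - 2))
    {g : G} (hg : g ≠ 0) :
    (3 : ℤ) ∣ (unitBall s 1 * unitBall s 2).coeff g - (signedSum s 3).coeff g +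
      (2 * n - 2) * (signedSum s 1).coeff g + (4 * n + 2) := by
  classical
  obtain ⟨W, hW⟩ := exists_unitBall_cube s
  have h1 : (2 : ℤ) • (unitBall s 1 * total G) + unitBall s 1 * unitBall s 2 +
      (2 * n - 2 : ℤ) • unitBall s 1 = unitBall s 3 + (3 : ℤ) • W := by
    simp only [zsmul_eq_mul]
    push_cast
    linear_combination hW - unitBall s 1 * hY
  have h2 := congrArg (fun F : ℤ[G] => F.coeff g) h1
  simp only [coeff_add, coeff_smul, Finsupp.add_apply, Finsupp.smul_apply, coeff_mul_total,
    augmentation_unitBall, smul_eq_mul] at h2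
  have h3 : ∀ k, (unitBall s k).coeff g = (signedSum s k).coeff g := by
    intro k
    simp [unitBall, coeff_one, hg]
  rw [h3, h3] at h2
  exact ⟨W.coeff g, by linarith⟩

/-- The terms on the left come from `0 = 0 + 2 • 0`, from `±sᵢ = ±sᵢ + 2 • 0` and from
`±3 sᵢ = ±sᵢ ± 2 sᵢ`. -/
theorem coeff_ge [DecidableEq G] (s : Fin n → G) (g : G) :
    (if g = 0 then 1 else 0) + (signedSum s 1).coeff g + (signedSum s 3).coeff g ≤
      (unitBall s 1 * unitBall s 2).coeff g := by
  have h : unitBall s 1 * unitBall s 2 =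
      1 + signedSum s 1 + signedSum s 2 + signedSum s 1 * signedSum s 2 := by
    simp only [unitBall]; ring
  rw [h]
  simp only [coeff_add, Finsupp.add_apply, coeff_one]
  have h1 := coeff_signedSum_mul_ge s g
  have h2 := coeff_signedSum_nonneg s 1 g
  have h3 := coeff_signedSum_nonneg s 2 g
  linarith

theorem sum_coeff (s : Fin n → G) :
    ∑ g, (unitBall s 1 * unitBall s 2).coeff g = (2 * n + 1) ^ 2 := by
  rw [← augmentation_eq_sum, map_mul, augmentation_unitBall, augmentation_unitBall, sq]

theorem coeff_neg_unitBall_mul (s : Fin n → G) (g : G) :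
    (unitBall s 1 * unitBall s 2).coeff (-g) = (unitBall s 1 * unitBall s 2).coeff g :=
  coeff_neg_mul (coeff_neg_unitBall s 1) (coeff_neg_unitBall s 2) g

theorem unitBall_two_sq
    (hY : unitBall s 1 ^ 2 = 2 * total G + unitBall s 2 + (2 * (n : ℤ[G]) - 2)) :
    unitBall s 2 ^ 2 = 2 * total G + unitBall s 4 + (2 * (n : ℤ[G]) - 2) := by
  have hY2 := congrArg (dilation G 2) hY
  simp only [map_pow, map_add, map_sub, map_mul, map_natCast, map_ofNat, dilation_unitBall,
    dilation_total (injective_two_smul (card_eq_of_unitBall_sq hY))] at hY2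
  norm_num at hY2
  exact hY2

/-- The sum of squares is the coefficient at `0` of `Y₁² Y₂²`, which the equations for `Y₁²` and
`Y₂²` make explicit. -/
theorem sum_coeff_sq
    (hY : unitBall s 1 ^ 2 = 2 * total G + unitBall s 2 + (2 * (n : ℤ[G]) - 2))
    (h0 : (unitBall s 1).coeff 0 = 1) :
    ∑ g, (unitBall s 1 * unitBall s 2).coeff g ^ 2 =
      12 * n ^ 2 + 12 * n + (unitBall s 1 * unitBall s 2).coeff 0 := by
  classical
  have hG := card_eq_of_unitBall_sq hY
  have hinj := injective_two_smul hG
  have hY2 := unitBall_two_sq hY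
  have h2 : (unitBall s 2).coeff 0 = 1 := by
    rw [← h0, ← coeff_unitBall_two_mul_zero hinj 1, mul_one]
  have h4 : (unitBall s 4).coeff 0 = 1 := by
    rw [← h2, ← coeff_unitBall_two_mul_zero hinj 2]; norm_num
  have h24 : (unitBall s 2 * unitBall s 4).coeff 0 = (unitBall s 1 * unitBall s 2).coeff 0 := by
    have := coeff_dilation hinj (unitBall s 1 * unitBall s 2) 0
    rw [map_mul, dilation_unitBall, dilation_unitBall, smul_zero] at this
    norm_num at this
    exact this
  have h1 : ∑ g, (unitBall s 1 * unitBall s 2).coeff g ^ 2 =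
      ((unitBall s 1 * unitBall s 2) * (unitBall s 1 * unitBall s 2)).coeff 0 := by
    rw [coeff_mul_eq_sum]
    refine sum_congr rfl fun g _ => ?_
    rw [zero_sub, coeff_neg_unitBall_mul, sq]
  have h3 : (unitBall s 1 * unitBall s 2) * (unitBall s 1 * unitBall s 2) =
      (4 * total G + 2 * unitBall s 2 + 2 * unitBall s 4 + 8 * (n : ℤ[G]) - 8) * total G +
        unitBall s 2 * unitBall s 4 + (2 * n - 2 : ℤ) • (unitBall s 2 + unitBall s 4) +
        ((2 * n - 2) ^ 2 : ℤ) • (1 : ℤ[G]) := by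
    simp only [zsmul_eq_mul]
    push_cast
    linear_combination unitBall s 2 ^ 2 * hY +
      (2 * total G + unitBall s 2 + (2 * (n : ℤ[G]) - 2)) * hY2
  rw [h1, h3]
  simp only [coeff_add, coeff_smul, Finsupp.add_apply, Finsupp.smul_apply, coeff_mul_total,
    smul_eq_mul, h2, h4, h24, map_add, map_sub, map_mul, map_natCast, map_ofNat,
    augmentation_unitBall, augmentation_total, coeff_one, hG, if_pos]
  ring

/-- The sum is the coefficient at `0` of `(Y₁ - 1) Y₁ Y₂`, where `Y₁² Y₂` is computed from the
equations for `Y₁²` and `Y₂²`. -/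
theorem sum_coeff_mul
    (hY : unitBall s 1 ^ 2 = 2 * total G + unitBall s 2 + (2 * (n : ℤ[G]) - 2))
    (h0 : (unitBall s 1).coeff 0 = 1) :
    ∑ g, (signedSum s 1).coeff g * (unitBall s 1 * unitBall s 2).coeff g =
      8 * n + 1 - (unitBall s 1 * unitBall s 2).coeff 0 := by
  classical
  have hinj := injective_two_smul (card_eq_of_unitBall_sq hY)
  have h2 : (unitBall s 2).coeff 0 = 1 := by
    rw [← h0, ← coeff_unitBall_two_mul_zero hinj 1, mul_one]
  have h4 : (unitBall s 4).coeff 0 = 1 := by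
    rw [← h2, ← coeff_unitBall_two_mul_zero hinj 2]; norm_num
  have h1 : ∑ g, (signedSum s 1).coeff g * (unitBall s 1 * unitBall s 2).coeff g =
      (signedSum s 1 * (unitBall s 1 * unitBall s 2)).coeff 0 := by
    rw [coeff_mul_eq_sum]
    refine sum_congr rfl fun g _ => ?_
    rw [zero_sub, coeff_neg_unitBall_mul]
  have h3 : signedSum s 1 * (unitBall s 1 * unitBall s 2) + unitBall s 1 * unitBall s 2 =
      (2 * unitBall s 2 + 2) * total G + unitBall s 4 +
        (2 * n - 2 : ℤ) • (1 + unitBall s 2) := by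
    have : signedSum s 1 = unitBall s 1 - 1 := (add_sub_cancel_left _ _).symm
    rw [this]
    simp only [zsmul_eq_mul]
    push_cast
    linear_combination unitBall s 2 * hY + unitBall_two_sq hY
  have h5 := congrArg (fun F : ℤ[G] => F.coeff 0) h3
  simp only [coeff_add, coeff_smul, Finsupp.add_apply, Finsupp.smul_apply, coeff_mul_total,
    smul_eq_mul, h2, h4, map_add, map_mul, map_ofNat, augmentation_unitBall, coeff_one,
    if_pos] at h5
  rw [h1]
  linarith

end Coefficients

/-! ### Inequalities for the coefficients -/

/-- Relations between three integer functions on a set `A` of size `2 n²`. They are satisfied by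
the coefficients `e`, `x`, `z` of `unitBall s 1 * unitBall s 2`, `signedSum s 1`, `signedSum s 3`
at the nonzero elements of the group, `e₀` and `z₀` being the coefficients of the first and the
third at `0`. -/
structure CoeffRelations {ι : Type*} (A : Finset ι) (e x z : ι → ℤ) (n e₀ z₀ : ℤ) : Prop where
  card : (#A : ℤ) = 2 * n ^ 2
  sum_e : ∑ g ∈ A, e g = (2 * n + 1) ^ 2 - e₀
  sum_e_sq : ∑ g ∈ A, e g ^ 2 = 12 * n ^ 2 + 12 * n + e₀ - e₀ ^ 2
  sum_x_mul_e : ∑ g ∈ A, x g * e g = 8 * n + 1 - e₀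
  sum_x : ∑ g ∈ A, x g = 2 * n
  sum_z : ∑ g ∈ A, z g = 2 * n - z₀
  x_eq : ∀ g ∈ A, x g = 0 ∨ x g = 1
  z_nonneg : ∀ g ∈ A, 0 ≤ z g
  le_e : ∀ g ∈ A, x g + z g ≤ e g
  z₀_nonneg : 0 ≤ z₀
  z₀_lt : z₀ + 1 ≤ e₀
  dvd : ∀ g ∈ A, (3 : ℤ) ∣ e g - z g + (2 * n - 2) * x g + (4 * n + 2)

namespace CoeffRelations

variable {ι : Type*} {A : Finset ι} {e x z : ι → ℤ} {n e₀ z₀ : ℤ}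

theorem sum_combination (h : CoeffRelations A e x z n e₀ z₀) (b p q r t : ℤ) :
    ∑ g ∈ A, (e g ^ 2 + b * e g + p * (x g * e g) + q * x g + r * z g + t) =
      (12 * n ^ 2 + 12 * n + e₀ - e₀ ^ 2) + b * ((2 * n + 1) ^ 2 - e₀) + p * (8 * n + 1 - e₀) +
        q * (2 * n) + r * (2 * n - z₀) + 2 * n ^ 2 * t := by
  simp only [sum_add_distrib, ← mul_sum, sum_const, nsmul_eq_mul, h.card, h.sum_e, h.sum_e_sq,
    h.sum_x_mul_e, h.sum_x, h.sum_z]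

/-- If `3 ∣ n`, then `e ≡ 1` modulo `3` at most places, and `(e - 1) (e - 4)` is negative only on
the supports of `x` and `z`. Its sum over `A` is too small for that. -/
theorem not_zero_mod_three (h : CoeffRelations A e x z n e₀ z₀) (hn : 3 ≤ n) : n % 3 ≠ 0 := by
  intro hmod
  -- The summand is `(e - 1) (e - 4) - 2 x (e - 4) + 2 z`.
  have hpt : ∀ g ∈ A, 0 ≤ e g ^ 2 + (-5) * e g + (-2) * (x g * e g) + 8 * x g + 2 * z g + 4 := by
    intro g hg
    have hd := h.dvd g hg
    have hz := h.z_nonneg g hg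
    rcases h.x_eq g hg with hx | hx
    · rw [hx] at hd ⊢
      rcases hz.eq_or_lt with hz0 | hz0
      · have : e g ≤ 1 ∨ 4 ≤ e g := by omega
        rcases this with h1 | h1 <;> nlinarith
      · have : e g ≤ 2 ∨ 3 ≤ e g := by omega
        rcases this with h1 | h1 <;> nlinarith
    · rw [hx]
      have : e g ≤ 3 ∨ 4 ≤ e g := by omega
      rcases this with h1 | h1 <;> nlinarith
  have hs := sum_nonneg hpt
  rw [h.sum_combination] at hs
  have := h.z₀_nonneg
  nlinarith [sq_nonneg (e₀ - 4)]

/-- If `n ≡ 1` modulo `3`, then `3 ∣ e` at most places, and `e (e - 3)` is negative only on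
the support of `z`. Its sum over `A` is too small for that. -/
theorem not_one_mod_three (h : CoeffRelations A e x z n e₀ z₀) (hn : 3 ≤ n) : n % 3 ≠ 1 := by
  intro hmod
  -- The summand is `e (e - 3) - 3 x (e - 3) + 2 z`.
  have hpt : ∀ g ∈ A, 0 ≤ e g ^ 2 + (-3) * e g + (-3) * (x g * e g) + 9 * x g + 2 * z g + 0 := by
    intro g hg
    have hd := h.dvd g hg
    have hz := h.z_nonneg g hg
    rcases h.x_eq g hg with hx | hx
    · rw [hx] at hd ⊢
      rcases hz.eq_or_lt with hz0 | hz0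
      · have : e g ≤ 0 ∨ 3 ≤ e g := by omega
        rcases this with h1 | h1 <;> nlinarith
      · have : e g ≤ 1 ∨ 2 ≤ e g := by omega
        rcases this with h1 | h1 <;> nlinarith
    · rw [hx]
      nlinarith [sq_nonneg (e g - 3)]
  have hs := sum_nonneg hpt
  rw [h.sum_combination] at hs
  have := h.z₀_nonneg
  have : 4 ≤ n := by omega
  nlinarith [sq_nonneg (2 * e₀ - 7)]

/-- If `n ≡ 2` modulo `3`, the bound `e ≥ x + z` improves to `e ≥ x + z + 2` by the congruence,
and the sum over `A` leaves no room for a strict inequality. -/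
theorem e_eq (h : CoeffRelations A e x z n e₀ z₀) (hmod : n % 3 = 2) :
    e₀ = z₀ + 1 ∧ ∀ g ∈ A, e g = x g + z g + 2 := by
  have hpt : ∀ g ∈ A, 0 ≤ e g - (x g + z g + 2) := by
    intro g hg
    have hd := h.dvd g hg
    have := h.le_e g hg
    rcases h.x_eq g hg with hx | hx <;> rw [hx] at hd this ⊢ <;> omega
  have hs : ∑ g ∈ A, (e g - (x g + z g + 2)) = z₀ + 1 - e₀ := by
    simp only [sum_add_distrib, sum_sub_distrib, sum_const, nsmul_eq_mul, h.card, h.sum_e,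
      h.sum_x, h.sum_z]
    ring
  have h0 := sum_nonneg hpt
  have h1 := h.z₀_lt
  refine ⟨by linarith, fun g hg => ?_⟩
  have := (sum_eq_zero_iff_of_nonneg hpt).1 (by linarith) g hg
  linarith

/-- The support of `z` is contained in that of `x`, since `∑ x e` forces `∑ x z = ∑ z`. -/
theorem x_eq_one_of_z_ne_zero (h : CoeffRelations A e x z n e₀ z₀) (hmod : n % 3 = 2) :
    ∀ g ∈ A, z g ≠ 0 → x g = 1 := by
  obtain ⟨he₀, he⟩ := h.e_eq hmod
  have hpt : ∀ g ∈ A, 0 ≤ z g + 3 * x g - x g * e g := by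
    intro g hg
    rw [he g hg]
    have := h.z_nonneg g hg
    rcases h.x_eq g hg with hx | hx <;> rw [hx] <;> linarith
  have hs : ∑ g ∈ A, (z g + 3 * x g - x g * e g) = 0 := by
    simp only [sum_add_distrib, sum_sub_distrib, ← mul_sum, h.sum_x_mul_e, h.sum_x, h.sum_z]
    linarith
  intro g hg hz
  have h1 := (sum_eq_zero_iff_of_nonneg hpt).1 hs g hg
  rw [he g hg] at h1
  rcases h.x_eq g hg with hx | hx
  · rw [hx] at h1; exact absurd (by linarith) hz
  · exact hx

theorem sum_z_sq (h : CoeffRelations A e x z n e₀ z₀) (hmod : n % 3 = 2) :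
    ∑ g ∈ A, z g ^ 2 = (2 * n - z₀) * (2 * n + z₀ - 5) := by
  obtain ⟨he₀, he⟩ := h.e_eq hmod
  have hpt : ∀ g ∈ A, z g ^ 2 =
      e g ^ 2 + 0 * e g + (-2) * (x g * e g) + x g + (-4) * z g + (-4) := by
    intro g hg
    rw [he g hg]
    rcases h.x_eq g hg with hx | hx <;> rw [hx] <;> ring
  have hs := h.sum_combination 0 (-2) 1 (-4) (-4)
  simp only [one_mul] at hs
  rw [sum_congr rfl hpt, hs, he₀]
  ring

end CoeffRelations

section Torsion

variable {G : Type*} [AddCommGroup G] [Fintype G] {n : ℕ} {s : Fin n → G}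

theorem coeffRelations [DecidableEq G]
    (h : total G = 1 + signedSum s 1 + ∑ S ∈ powersetCard 2 univ, ∏ i ∈ S, pm (s i)) :
    CoeffRelations (univ.erase (0 : G)) (unitBall s 1 * unitBall s 2).coeff
      (signedSum s 1).coeff (signedSum s 3).coeff n ((unitBall s 1 * unitBall s 2).coeff 0)
      ((signedSum s 3).coeff 0) := by
  have hY := unitBall_sq h
  obtain ⟨hx0, hx⟩ := coeff_signedSum_zero_one h
  have h0 : (unitBall s 1).coeff 0 = 1 := by simp [unitBall, hx0]
  have hs : ∀ k, ∑ g, (signedSum s k).coeff g = 2 * n := fun k => by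
    rw [← augmentation_eq_sum, augmentation_signedSum]
  refine ⟨?_, ?_, ?_, ?_, ?_, ?_, fun g _ => hx g, fun g _ => coeff_signedSum_nonneg s 3 g, ?_,
    coeff_signedSum_nonneg s 3 0, ?_, ?_⟩
  · have := card_eq_of_unitBall_sq hY
    rw [card_erase_of_mem (mem_univ _), Nat.cast_sub (card_pos.2 ⟨0, mem_univ _⟩), card_univ, this]
    push_cast
    ring
  · rw [sum_erase_eq_sub (mem_univ _), sum_coeff]
  · rw [sum_erase_eq_sub (mem_univ _), sum_coeff_sq hY h0]
  · rw [sum_erase_eq_sub (mem_univ _), sum_coeff_mul hY h0, hx0, zero_mul, sub_zero]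
  · rw [sum_erase_eq_sub (mem_univ _), hs, hx0, sub_zero]
  · rw [sum_erase_eq_sub (mem_univ _), hs]
  · intro g hg
    have := coeff_ge s g
    rwa [if_neg (ne_of_mem_erase hg), zero_add] at this
  · have := coeff_ge s 0
    rw [if_pos rfl, hx0] at this
    linarith
  · exact fun g hg => coeff_mod_three hY (ne_of_mem_erase hg)

/-- In a tiling `n ≡ 2` modulo `3` and all generators have order three. If not all `3 sᵢ` vanish,
then by `sum_z_sq` some nonzero element equals `±3 sᵢ` in too many ways, as `g` and `-g` share the
total `2 n - z 0`. -/
theorem mod_three_and_smul_eq_zero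
    (h : total G = 1 + signedSum s 1 + ∑ S ∈ powersetCard 2 univ, ∏ i ∈ S, pm (s i))
    (hn : 3 ≤ n) : n % 3 = 2 ∧ ∀ i, (3 : ℤ) • s i = 0 := by
  classical
  have hR := coeffRelations h
  have hn' : (3 : ℤ) ≤ n := by exact_mod_cast hn
  have hmod : (n : ℤ) % 3 = 2 := by
    have := hR.not_zero_mod_three hn'
    have := hR.not_one_mod_three hn'
    omega
  refine ⟨by omega, smul_eq_zero_of_coeff_signedSum_zero ?_⟩
  have hinj := injective_two_smul (card_eq_of_unitBall_sq (unitBall_sq h))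
  have h2 : ∀ g : G, (2 : ℤ) • g = 0 → g = 0 := fun g hg => hinj (by simpa using hg)
  have hz2 := hR.sum_z_sq hmod
  have hz1 := hR.sum_z
  have hz0 := hR.z₀_nonneg
  have hx1 := hR.x_eq_one_of_z_ne_zero hmod
  have hzn := coeff_signedSum_nonneg s 3
  have hzneg := coeff_neg_signedSum s 3
  have hx3 := coeff_signedSum_le_smul s 3
  set z := (signedSum s 3).coeff
  by_contra hne
  have hw : 0 < 2 * n - z 0 := by
    have h1 : 0 ≤ 2 * n - z 0 := hz1 ▸ sum_nonneg fun g _ => hzn g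
    omega
  have hne_neg : ∀ g : G, g ≠ 0 → g ≠ -g := fun g hg h' => hg (h2 g (by
    rw [two_smul]; exact add_eq_zero_iff_eq_neg.2 h'))
  have hpair : ∀ g ∈ univ.erase (0 : G), 2 * z g ≤ 2 * n - z 0 := by
    intro g hg
    have hg0 := ne_of_mem_erase hg
    rw [← hz1]
    calc 2 * z g = ∑ k ∈ {g, -g}, z k := by rw [sum_pair (hne_neg g hg0), hzneg]; ring
      _ ≤ _ := sum_le_sum_of_subset_of_nonneg (by
        intro k hk
        simp only [mem_insert, mem_singleton] at hk
        rcases hk with rfl | rfl <;> simp [hg0]) fun k _ _ => hzn k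
  have hsum : ∀ w : ℤ, (∀ g ∈ univ.erase (0 : G), z g ≠ 0 → 2 * z g ≤ w) →
      2 * (2 * n + z 0 - 5) ≤ w := by
    intro w hw'
    have h1 : 0 ≤ ∑ g ∈ univ.erase (0 : G), (w * z g - 2 * z g ^ 2) := by
      refine sum_nonneg fun g hg => ?_
      by_cases h0 : z g = 0
      · simp [h0]
      · nlinarith [hzn g, hw' g hg h0]
    rw [sum_sub_distrib, ← mul_sum, ← mul_sum, hz1, hz2] at h1
    refine le_of_mul_le_mul_left ?_ hw
    linarith
  have h5 := hsum _ fun g hg _ => hpair g hg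
  have hz00 : z 0 = 0 := by omega
  -- Now `n = 5` is the only case left. A nonzero `g = 3 s` is again one of the `±sᵢ`, hence `3 g`
  -- also contributes to the sum of the `z g`, which improves the bound on `z g`.
  have h6 := hsum (2 * n - 1) fun g hg hzg => by
    have hg0 := ne_of_mem_erase hg
    have h3g : 1 ≤ z ((3 : ℤ) • g) := hx1 g hg hzg ▸ hx3 g
    have hg1 : g ≠ (3 : ℤ) • g := fun h' => hg0 (h2 g (by
      rw [show (2 : ℤ) = 3 - 1 by norm_num, sub_smul, ← h', one_smul, sub_self]))
    have hg2 : -g ≠ (3 : ℤ) • g := fun h' => hg0 (h2 g (h2 _ (by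
      rw [smul_smul, show (2 : ℤ) * 2 = 3 + 1 by norm_num, add_smul, ← h', one_smul,
        neg_add_cancel])))
    have hg3 : (3 : ℤ) • g ≠ 0 := fun h' => by rw [h', hz00] at h3g; omega
    have hle : ∑ k ∈ {g, -g, (3 : ℤ) • g}, z k ≤ ∑ k ∈ univ.erase (0 : G), z k :=
      sum_le_sum_of_subset_of_nonneg (by
        intro k hk
        simp only [mem_insert, mem_singleton] at hk
        rcases hk with rfl | rfl | rfl <;> simp [hg0, hg3]) fun k _ _ => hzn k
    rw [sum_insert (by simp [hne_neg g hg0, hg1]), sum_pair hg2, hzneg, hz1, hz00] at hle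
    linarith
  omega

end Torsion

/-! ### Characters of elementary abelian 3-groups -/

section Characters

variable {G : Type*} [AddCommGroup G]

/-- The ring homomorphism from the integral group ring to `ℂ` that extends a character. -/
noncomputable def charEval (ψ : AddChar G ℂ) : ℤ[G] →+* ℂ :=
  (AddMonoidAlgebra.lift ℤ ℂ G ψ.toMonoidHom).toRingHom

theorem charEval_single (ψ : AddChar G ℂ) (x : G) : charEval ψ (single x 1) = ψ x := by
  simp [charEval, AddMonoidAlgebra.lift_single]

/-- Orthogonality to the trivial character. -/
theorem charEval_total [Fintype G] {ψ : AddChar G ℂ} (hψ : ψ ≠ 0) :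
    charEval ψ (total G) = 0 := by
  simpa [total, charEval_single] using AddChar.sum_eq_zero_iff_ne_zero.2 hψ

theorem charEval_zero (F : ℤ[G]) : charEval 0 F = augmentation G F := by
  have : charEval (0 : AddChar G ℂ) = (Int.castRingHom ℂ).comp (augmentation G) := by
    refine AddMonoidAlgebra.ringHom_ext (fun r => ?_) fun x => ?_
    · simp [charEval, augmentation, AddMonoidAlgebra.lift_single]
    · simp [charEval_single, augmentation_single]
  rw [this]; rfl

/-- Fourier inversion at `0`. -/
theorem sum_charEval [Fintype G] (F : ℤ[G]) :
    ∑ ψ : AddChar G ℂ, charEval ψ F = Fintype.card G * F.coeff 0 := by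
  classical
  have h : ∀ ψ : AddChar G ℂ, charEval ψ F = ∑ g, F.coeff g * ψ g := by
    intro ψ
    simp [charEval, AddMonoidAlgebra.lift_apply, Finsupp.sum_fintype]
  simp only [h]
  rw [sum_comm]
  simp only [← mul_sum, AddChar.sum_apply_eq_ite, mul_ite, mul_zero, sum_ite_eq', mem_univ,
    if_true]
  exact mul_comm _ _

/-- A character value `ω` satisfies `ω ^ 3 = 1`, hence `ω + ω⁻¹` is `2` or `-1`. -/
theorem exists_charEval_unitBall (hG : ∀ g : G, (3 : ℤ) • g = 0) (ψ : AddChar G ℂ) {n : ℕ}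
    (s : Fin n → G) (k : ℤ) : ∃ y : ℤ, charEval ψ (unitBall s k) = y := by
  have h : ∀ x : G, ∃ y : ℤ, charEval ψ (pm x) = y := by
    intro x
    have h2 : -x = x + x := by
      rw [neg_eq_iff_add_eq_zero, ← hG x, show (3 : ℤ) = 1 + (1 + 1) by norm_num]
      simp only [add_smul, one_smul]
    have h3 : ψ x ^ 3 = 1 := by
      rw [← AddChar.map_nsmul_eq_pow, ← natCast_zsmul]
      exact (congrArg ψ (hG x)).trans (AddChar.map_zero_eq_one ψ)
    have h4 : (ψ x - 1) * (ψ x + ψ x * ψ x + 1) = 0 := by linear_combination h3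
    rw [pm, map_add, charEval_single, charEval_single, h2, AddChar.map_add_eq_mul]
    rcases mul_eq_zero.1 h4 with h5 | h5
    · refine ⟨2, ?_⟩
      rw [sub_eq_zero.1 h5]; norm_num
    · refine ⟨-1, ?_⟩
      push_cast
      linear_combination h5
  choose f hf using h
  refine ⟨1 + ∑ i, f (k • s i), ?_⟩
  simp [unitBall, signedSum, hf]

theorem smul_eq_zero_of_surjective {n : ℕ} {φ : (Fin n → ℤ) →+ G} (hφ : Function.Surjective φ)
    {k : ℤ} (h : ∀ i, k • φ (Pi.single i 1) = 0) (g : G) : k • g = 0 := by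
  obtain ⟨x, rfl⟩ := hφ g
  rw [pi_eq_sum_univ' x, map_sum, smul_sum]
  refine sum_eq_zero fun i _ => ?_
  rw [map_zsmul, smul_comm, h, smul_zero]

/-- With `m = 2 y - 1` one has `8 n = m ^ 2 + 7`, and the divisibility reduces to `m ∣ 63`. -/
theorem eq_eleven_of_dvd {n : ℕ} {y : ℤ} (hn : 3 ≤ n) (hmod : n % 3 = 2)
    (hy : y ^ 2 = y + (2 * n - 2)) (hd : 2 * y - 1 ∣ 2 * n ^ 2 - 2 * n - 2 * n ^ 2 * y) :
    n = 11 ∨ n = 56 ∨ n = 497 := by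
  obtain ⟨m, hm⟩ : ∃ m, m = 2 * y - 1 := ⟨_, rfl⟩
  have hnm : 8 * (n : ℤ) = m ^ 2 + 7 := by rw [hm]; linear_combination -4 * hy
  rw [← hm] at hd
  have h63 : m ∣ 63 := by
    have h1 : (63 : ℤ) = m * (m ^ 3 + 14 * m - m ^ 4 - 14 * m ^ 2 - 49 - 16 * m) -
        64 * (2 * n ^ 2 - 2 * n - 2 * n ^ 2 * y) := by
      have h2 : 64 * (2 * (n : ℤ) ^ 2 - 2 * n - 2 * n ^ 2 * y) =
          (8 * n) ^ 2 * (1 - m) - 16 * (8 * n) := by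
        rw [hm]; ring
      rw [h2, hnm]
      ring
    rw [h1]
    exact dvd_sub (dvd_mul_right _ _) (hd.mul_left _)
  have hdiv : m.natAbs ∈ Nat.divisors 63 :=
    Nat.mem_divisors.2 ⟨Int.natCast_dvd_natCast.1 (by simpa using h63), by norm_num⟩
  rw [show Nat.divisors 63 = {1, 3, 7, 9, 21, 63} by decide +kernel] at hdiv
  rw [← Int.natAbs_sq] at hnm
  simp only [mem_insert, mem_singleton] at hdiv
  rcases hdiv with h | h | h | h | h | h <;> rw [h] at hnm <;> norm_num at hnm <;> omega

/-- The character sums of the unit ball at nontrivial characters are integral roots of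
`y ^ 2 = y + 2 n - 2`. Their sum over all characters is the order of the group, which restricts `n`
to `11`, `56` and `497`. The last two are excluded because the order of the group is a power
of `3`. -/
theorem eq_eleven [Fintype G] (hG : ∀ g : G, (3 : ℤ) • g = 0) {n : ℕ} (hn : 3 ≤ n)
    (hmod : n % 3 = 2) {s : Fin n → G}
    (h : total G = 1 + signedSum s 1 + ∑ S ∈ powersetCard 2 univ, ∏ i ∈ S, pm (s i)) :
    n = 11 := by
  classical
  have hY := unitBall_sq h
  have hcard := card_eq_of_unitBall_sq hY
  have hcard' : Fintype.card G = 2 * n ^ 2 + 1 := by exact_mod_cast hcard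
  have h21 : unitBall s 2 = unitBall s 1 := by
    have : ∀ x : G, (2 : ℤ) • x = -x := fun x => by
      rw [eq_neg_iff_add_eq_zero, ← hG x, show (3 : ℤ) = 2 + 1 by norm_num, add_smul 2 1, one_smul]
    simp only [unitBall, signedSum, this, one_smul, pm, neg_neg]
    simp only [add_comm]
  rw [h21] at hY
  choose y hy using fun ψ : AddChar G ℂ => exists_charEval_unitBall hG ψ s 1
  have hy_sq : ∀ ψ, ψ ≠ 0 → y ψ ^ 2 = y ψ + (2 * n - 2) := by
    intro ψ hψ
    have := congrArg (charEval ψ) hY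
    simp only [map_pow, map_add, map_sub, map_mul, map_natCast, map_ofNat, hy,
      charEval_total hψ] at this
    have h2 : ((y ψ ^ 2 : ℤ) : ℂ) = ((y ψ + (2 * n - 2) : ℤ) : ℂ) := by
      push_cast
      linear_combination this
    exact_mod_cast h2
  have hy_zero : y 0 = 2 * n + 1 := by
    have h1 := hy 0
    rw [charEval_zero, augmentation_unitBall] at h1
    exact_mod_cast h1.symm
  have hy_sum : ∑ ψ, y ψ = 2 * n ^ 2 + 1 := by
    have h1 := sum_charEval (unitBall s 1)
    have h0 : (unitBall s 1).coeff 0 = 1 := by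
      simp [unitBall, (coeff_signedSum_zero_one h).1]
    simp only [hy, h0, hcard', Int.cast_one, mul_one] at h1
    exact_mod_cast h1
  have hchar : Fintype.card (AddChar G ℂ) = 2 * n ^ 2 + 1 := by rw [AddChar.card_eq, hcard']
  have : Nontrivial (AddChar G ℂ) := by
    rw [← Fintype.one_lt_card_iff_nontrivial, hchar]
    nlinarith
  obtain ⟨ψ₀, hψ₀⟩ := exists_ne (0 : AddChar G ℂ)
  -- All values at nontrivial characters are roots of the same quadratic, and its roots differ
  -- by `2 y - 1`.
  have hd : ∀ ψ ∈ univ.erase (0 : AddChar G ℂ), 2 * y ψ₀ - 1 ∣ y ψ - y ψ₀ := by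
    intro ψ hψ
    have h1 : (y ψ - y ψ₀) * (y ψ + y ψ₀ - 1) = 0 := by
      linear_combination hy_sq ψ (ne_of_mem_erase hψ) - hy_sq ψ₀ hψ₀
    rcases mul_eq_zero.1 h1 with h2 | h2
    · rw [h2]; exact dvd_zero _
    · exact ⟨-1, by linarith⟩
  have hd' := dvd_sum hd
  rw [sum_sub_distrib, sum_erase_eq_sub (mem_univ _), hy_sum, hy_zero, sum_const,
    card_erase_of_mem (mem_univ _), card_univ, hchar, Nat.add_sub_cancel, nsmul_eq_mul] at hd'
  have hprime : ∀ p : ℕ, p.Prime → p ∣ Fintype.card G → p = 3 := by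
    intro p hp hpG
    have : Fact p.Prime := ⟨hp⟩
    obtain ⟨g, hg⟩ := exists_prime_addOrderOf_dvd_card p hpG
    have h3 : addOrderOf g ∣ 3 := addOrderOf_dvd_of_nsmul_eq_zero (by
      rw [← natCast_zsmul]; exact hG g)
    rw [hg] at h3
    exact (Nat.prime_dvd_prime_iff_eq hp Nat.prime_three).1 h3
  rw [hcard'] at hprime
  rcases eq_eleven_of_dvd hn hmod (hy_sq ψ₀ hψ₀) (by
    push_cast at hd'
    rw [show 2 * (n : ℤ) ^ 2 - 2 * n - 2 * n ^ 2 * y ψ₀ =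
      2 * n ^ 2 + 1 - (2 * n + 1) - 2 * n ^ 2 * y ψ₀ by ring]
    exact hd') with rfl | rfl | rfl
  · rfl
  · exact absurd (hprime 17 (by norm_num) (by norm_num)) (by norm_num)
  · exact absurd (hprime 19 (by norm_num) (by norm_num)) (by norm_num)

end Characters

/-! ### The ternary Golay code -/

/-- A systematic generator matrix of the perfect ternary Golay code is `(1 | golayBlock)`. -/
def golayBlock : Matrix (Fin 6) (Fin 5) (ZMod 3) :=
  !![1, 1, 1, 1, 1;
     0, 1, 2, 2, 1;
     1, 0, 1, 2, 2;
     2, 1, 0, 1, 2;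
     2, 2, 1, 0, 1;
     1, 2, 2, 1, 0]

/-- The syndrome map of the perfect ternary Golay code, on integer vectors. -/
def golaySyndrome : (Fin 11 → ℤ) →+ (Fin 5 → ZMod 3) where
  toFun a j := a (Fin.natAdd 6 j) - ∑ i, (a (Fin.castAdd 5 i) : ZMod 3) * golayBlock i j
  map_zero' := by ext; simp
  map_add' a b := by
    ext j
    simp only [Pi.add_apply, Int.cast_add, add_mul, sum_add_distrib]
    ring

/-- Every nonzero word of the Golay code has weight at least `5`, by exhaustion of the `3 ^ 6`
words. -/
theorem golay_weight : ∀ a b c d e f : ZMod 3,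
    (if a = 0 then 0 else 1) + (if b = 0 then 0 else 1) + (if c = 0 then 0 else 1) +
    (if d = 0 then 0 else 1) + (if e = 0 then 0 else 1) + (if f = 0 then 0 else 1) +
    ∑ j, (if ∑ i, ![a, b, c, d, e, f] i * golayBlock i j = 0 then 0 else 1) ≤ 4 →
    a = 0 ∧ b = 0 ∧ c = 0 ∧ d = 0 ∧ e = 0 ∧ f = 0 := by
  decide +kernel

/-- Two elements of the ball differ by a vector of weight at most `4`, and the minimum distance of the
code is `5`. Modulo `3` the elements are therefore equal, which determines entries in `{-1, 0, 1}`. -/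
theorem bijOn_golaySyndrome : Set.BijOn golaySyndrome (errorBall 11 2 1 1) Set.univ := by
  have hinj : Set.InjOn golaySyndrome (errorBall 11 2 1 1) := by
    intro a ha b hb hab
    have h0 : golaySyndrome (a - b) = 0 := by rw [map_sub, hab, sub_self]
    set d := a - b with hd
    have hcheck : ∀ j : Fin 5, (d (Fin.natAdd 6 j) : ZMod 3) =
        ∑ i, (d (Fin.castAdd 5 i) : ZMod 3) * golayBlock i j := fun j =>
      sub_eq_zero.1 (congrFun h0 j)
    have hw : ∑ i : Fin (6 + 5), (if (d i : ZMod 3) = 0 then 0 else 1) ≤ 4 := by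
      have h1 : hammingNorm d ≤ 4 := by
        have h2 := hammingDist_triangle a 0 b
        rw [hammingDist_zero_right, hammingDist_zero_left] at h2
        have h3 : hammingDist a b = hammingNorm d := by
          rw [hammingDist_comm, hammingDist_eq_hammingNorm, hd, sub_eq_neg_add]
        have := ha.2
        have := hb.2
        omega
      refine le_trans ?_ h1
      rw [hammingNorm, card_filter]
      refine sum_le_sum fun i _ => ?_
      by_cases hi : d i = 0
      · simp [hi]
      · rw [if_pos hi]; split_ifs <;> simp
    rw [Fin.sum_univ_add] at hw
    simp only [hcheck] at hw
    have hu : (fun i : Fin 6 => (d (Fin.castAdd 5 i) : ZMod 3)) =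
        ![(d (Fin.castAdd 5 0) : ZMod 3), d (Fin.castAdd 5 1), d (Fin.castAdd 5 2),
          d (Fin.castAdd 5 3), d (Fin.castAdd 5 4), d (Fin.castAdd 5 5)] := by
      funext i; fin_cases i <;> rfl
    have hg := golay_weight (d (Fin.castAdd 5 0)) (d (Fin.castAdd 5 1)) (d (Fin.castAdd 5 2))
      (d (Fin.castAdd 5 3)) (d (Fin.castAdd 5 4)) (d (Fin.castAdd 5 5)) (by
        rw [← hu]
        simpa only [Fin.sum_univ_six] using hw)
    have hleft : ∀ i : Fin 6, (d (Fin.castAdd 5 i) : ZMod 3) = 0 := by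
      intro i
      obtain ⟨g0, g1, g2, g3, g4, g5⟩ := hg
      fin_cases i <;> assumption
    have hall : ∀ i : Fin (6 + 5), (d i : ZMod 3) = 0 := by
      intro i
      refine Fin.addCases hleft (fun j => ?_) i
      rw [hcheck]
      simp [hleft]
    funext i
    have h3 : (3 : ℤ) ∣ d i := (ZMod.intCast_zmod_eq_zero_iff_dvd _ 3).1 (hall i)
    have ha1 := ha.1 i
    have hb1 := hb.1 i
    simp only [Set.mem_Icc, Nat.cast_one] at ha1 hb1
    rw [hd, Pi.sub_apply] at h3
    omega
  refine bijOn_of_injOn_of_card_le hinj ?_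
  simp [sum_range_succ, ZMod.card, Nat.choose]

end LatticeTiling

theorem theorem1 (n : ℕ) (hn : 3 ≤ n) :
    (∃ Λ : AddSubgroup (Fin n → ℤ), IsLatticeTiling Λ (errorBall n 2 1 1)) ↔ n = 11 := by
  constructor
  · rintro ⟨Λ, hΛ⟩
    have := hΛ.finiteIndex
    let _ : Fintype ((Fin n → ℤ) ⧸ Λ) := Fintype.ofFinite _
    have h := LatticeTiling.total_eq_of_bijOn (LatticeTiling.bijOn_of_isLatticeTiling hΛ)
      fun _ => rfl
    obtain ⟨hmod, hs⟩ := LatticeTiling.mod_three_and_smul_eq_zero h hn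
    exact LatticeTiling.eq_eleven
      (LatticeTiling.smul_eq_zero_of_surjective (QuotientAddGroup.mk'_surjective Λ) hs) hn hmod h
  · rintro rfl
    exact ⟨_, LatticeTiling.isLatticeTiling_ker _ LatticeTiling.bijOn_golaySyndrome⟩
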